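/- Let $n\ge 1$ and $0<\lambda\le\Lambda<\infty$. For $r>0$ let $B_r\subset\mathbb R^n$ be the open ball of radius $r$ centred at $0$. There is a constant $A>1$, depending only on $n$, $\lambda$ and $\Lambda$, with the following property. Let $r>0$, and let $a_{ij}$ ($1\le i,j\le n$) be measurable functions on $B_r$ (not necessarily symmetric in $i,j$) such that for almost every $x\in B_r$ $$\lambda|\xi|^2\le \sum_{i,j}a_{ij}(x)\xi_i\xi_j\le\Lambda|\xi|^2\quad\text{for all }\xi\in\mathbb R^n,\qquad |a_{ij}(x)|\le\Lambda\quad\text{for all }i,j.$$ Let $u\in H^1(B_r)$ with $u\ge 0$ a.e. in $B_r$ be a subsolution of $-D_j(a_{ij}D_iu)=0$ in $B_r$, that is, $$\int_{B_r}\sum_{i,j}a_{ij}\,D_iu\,D_jv\,dx\le 0\qquad\text{for every } v\in H^1_0(B_r)\text{ with } v\ge 0 \text{ a.e.}$$ Put $$m=\left(\frac1{|B_r|}\int_{B_r}u^2\,dx\right)^{1/2}.$$ Then $v=(u-Am)^+$ satisfies $$\left(\frac1{|B_{r/2}|}\int_{B_{r/2}}v^2\,dx\right)^{1/2}\le\frac12\,m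 .$$ The case $r=1$ is included, and the same constant $A$ serves for all $r>0$. -/

import Mathlib

open MeasureTheory Filter Topology
open scoped ContDiff

namespace DeGiorgi

/-- The `i`-th classical partial derivative `D_i φ` on `ℝⁿ`. -/
noncomputable def partialDeriv {n : ℕ} (i : Fin n) (φ : EuclideanSpace ℝ (Fin n) → ℝ)
    (x : EuclideanSpace ℝ (Fin n)) : ℝ :=
  fderiv ℝ φ x (EuclideanSpace.single i 1)

/-- `φ ∈ C_c^∞(Ω)`. -/
structure IsTestFunction {n : ℕ} (Ω : Set (EuclideanSpace ℝ (Fin n)))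
    (φ : EuclideanSpace ℝ (Fin n) → ℝ) : Prop where
  smooth : ContDiff ℝ ∞ φ
  hasCompactSupport : HasCompactSupport φ
  tsupport_subset : tsupport φ ⊆ Ω

/-- `u ∈ H¹(Ω)`, and `Du = (D_1 u, …, D_n u)` is its weak gradient:
`u` and all `D_i u` are in `L²(Ω)` and `∫_Ω u D_i φ = - ∫_Ω (D_i u) φ` for all `φ ∈ C_c^∞(Ω)`. -/
structure IsH1 {n : ℕ} (Ω : Set (EuclideanSpace ℝ (Fin n)))
    (u : EuclideanSpace ℝ (Fin n) → ℝ) (Du : Fin n → EuclideanSpace ℝ (Fin n) → ℝ) : Prop where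
  memLp : MemLp u 2 (volume.restrict Ω)
  memLp_deriv : ∀ i, MemLp (Du i) 2 (volume.restrict Ω)
  weak_deriv : ∀ φ, IsTestFunction Ω φ → ∀ i,
    ∫ x in Ω, u x * partialDeriv i φ x = - ∫ x in Ω, Du i x * φ x

/-- `v ∈ H¹₀(Ω)`, with weak gradient `Dv`: `v ∈ H¹(Ω)` is the limit in the norm of `H¹(Ω)` of a
sequence in `C_c^∞(Ω)`. -/
structure IsH10 {n : ℕ} (Ω : Set (EuclideanSpace ℝ (Fin n)))
    (v : EuclideanSpace ℝ (Fin n) → ℝ) (Dv : Fin n → EuclideanSpace ℝ (Fin n) → ℝ) : Prop where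
  isH1 : IsH1 Ω v Dv
  exists_approx : ∃ φ : ℕ → EuclideanSpace ℝ (Fin n) → ℝ,
    (∀ k, IsTestFunction Ω (φ k)) ∧
    Tendsto (fun k => eLpNorm (fun x => φ k x - v x) 2 (volume.restrict Ω)) atTop (𝓝 0) ∧
    ∀ i, Tendsto (fun k => eLpNorm (fun x => partialDeriv i (φ k) x - Dv i x) 2
      (volume.restrict Ω)) atTop (𝓝 0)

/-- The coefficients `a = (a_ij)` are measurable on `Ω` and uniformly elliptic there with ellipticity
constants `lam`, `Lam`. No symmetry of `a` is assumed. -/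
structure IsUniformlyElliptic {n : ℕ} (lam Lam : ℝ) (Ω : Set (EuclideanSpace ℝ (Fin n)))
    (a : EuclideanSpace ℝ (Fin n) → Matrix (Fin n) (Fin n) ℝ) : Prop where
  aemeasurable : ∀ i j, AEMeasurable (fun x => a x i j) (volume.restrict Ω)
  lower : ∀ᵐ x ∂(volume.restrict Ω), ∀ ξ : EuclideanSpace ℝ (Fin n),
    lam * ‖ξ‖ ^ 2 ≤ ∑ i, ∑ j, a x i j * ξ i * ξ j
  upper : ∀ᵐ x ∂(volume.restrict Ω), ∀ ξ : EuclideanSpace ℝ (Fin n),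
    ∑ i, ∑ j, a x i j * ξ i * ξ j ≤ Lam * ‖ξ‖ ^ 2
  bound : ∀ᵐ x ∂(volume.restrict Ω), ∀ i j, |a x i j| ≤ Lam

/-- `u ∈ H¹(Ω)` is a (weak) subsolution in `Ω`: `-D_j (a_ij D_i u) ≤ 0`, that is,
`∫_Ω a_ij D_i u D_j v ≤ 0` for all nonnegative `v ∈ H¹₀(Ω)`. -/
def IsSubsolution {n : ℕ} (a : EuclideanSpace ℝ (Fin n) → Matrix (Fin n) (Fin n) ℝ)
    (Ω : Set (EuclideanSpace ℝ (Fin n))) (u : EuclideanSpace ℝ (Fin n) → ℝ) : Prop :=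
  ∃ Du : Fin n → EuclideanSpace ℝ (Fin n) → ℝ, IsH1 Ω u Du ∧
    ∀ (v : EuclideanSpace ℝ (Fin n) → ℝ) (Dv : Fin n → EuclideanSpace ℝ (Fin n) → ℝ),
      IsH10 Ω v Dv → (∀ᵐ x ∂(volume.restrict Ω), 0 ≤ v x) →
        ∫ x in Ω, ∑ i, ∑ j, a x i j * Du i x * Dv j x ≤ 0

/-- The `L²`-average `(⨍_E f²)^{1/2}` of `f` over `E`. -/
noncomputable def l2Average {n : ℕ} (E : Set (EuclideanSpace ℝ (Fin n)))
    (f : EuclideanSpace ℝ (Fin n) → ℝ) : ℝ :=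
  Real.sqrt (⨍ x in E, f x ^ 2)

end DeGiorgi

namespace DeGiorgi

open scoped ENNReal Convolution

/-! Let `η` be a cutoff equal to 1 on `B_{r/2}`, supported in `B_{3r/4}`, with `|D_i η| ≤ M / r`.
Testing the subsolution inequality with `η² u` gives the Caccioppoli estimate, so `w = η u`,
extended by zero, has gradient of `L²(ℝⁿ)` size at most `(C M / r) ‖u‖`, the norm of `u` being taken
over `B_r` (`exists_energy_bound`).

No Sobolev inequality is needed. Translating `w` by `y` changes it in `L²` by at most `|y|` times
its gradient norm, so the mean `w̄` of `w` over balls of radius `δ r` satisfies `‖w̄ - w‖ ≤ δ C M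
‖u‖`. By Jensen, `|w̄| ≤ |B_{δr}|^{-1/2} ‖u‖ ≤ K` everywhere once `K` is large. Then `(w - K)⁺ ≤ |w
- w̄|` pointwise (`eLpNorm_truncation_le`), and `w = u` on `B_{r/2}`. The radius `r` has cancelled;
a small `δ`, followed by a level `K = A m` large in terms of `δ`, gives the theorem. The truncation
itself need not be weakly differentiable or a subsolution.

The identification of `η u` as an element of `H¹₀`, and the translation bound for it, come from
mollification. -/

/-! ### Translations and averages in `L²`. -/

lemma eLpNorm_two_sq {α F : Type*} [MeasurableSpace α] {μ : Measure α} [NormedAddCommGroup F]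
    (f : α → F) : eLpNorm f 2 μ ^ 2 = ∫⁻ x, ‖f x‖ₑ ^ 2 ∂μ := by
  have := eLpNorm_nnreal_pow_eq_lintegral (f := f) (μ := μ) (p := 2) (by simp)
  simpa using this

lemma sq_lintegral_le {α : Type*} [MeasurableSpace α] {μ : Measure α} [IsProbabilityMeasure μ]
    {f : α → ℝ≥0∞} (hf : AEMeasurable f μ) : (∫⁻ x, f x ∂μ) ^ 2 ≤ ∫⁻ x, f x ^ 2 ∂μ := by
  have := ENNReal.lintegral_mul_le_Lp_mul_Lq μ Real.HolderConjugate.two_two hf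
    (aemeasurable_const (b := 1))
  simp at this
  calc _ ≤ ((∫⁻ x, f x ^ 2 ∂μ) ^ (2⁻¹ : ℝ)) ^ 2 := by gcongr
    _ = _ := by rw [← ENNReal.rpow_natCast, ← ENNReal.rpow_mul]; simp

/-- Translations act continuously on `L²`. -/
lemma tendsto_eLpNorm_translate_sub {n : ℕ} {f : EuclideanSpace ℝ (Fin n) → ℝ}
    (hf : MemLp f 2 volume) :
    Tendsto (fun y => eLpNorm (fun x => f (x - y) - f x) 2 volume) (𝓝 0) (𝓝 0) := by
  have : Fact ((2 : ℝ≥0∞) ≠ ⊤) := ⟨by simp⟩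
  -- Translation by `y` is the action of `DomAddAct` on `Lp`, which is continuous for finite
  -- exponents.
  have h : Continuous (fun y : EuclideanSpace ℝ (Fin n) =>
      (DomAddAct.mk (-y) +ᵥ hf.toLp f : Lp ℝ 2 volume)) :=
    (DomAddAct.continuous_mk.comp continuous_neg).vadd continuous_const
  have h1 := h.tendsto 0
  rw [neg_zero, DomAddAct.mk_zero, zero_vadd, tendsto_iff_edist_tendsto_0] at h1
  refine h1.congr fun y => ?_
  rw [DomAddAct.mk_vadd_toLp, Lp.edist_toLp_toLp]
  congr 1
  ext x
  simp [sub_eq_neg_add]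

/-- Jensen's inequality for averages of translates. -/
lemma eLpNorm_average_sub_le {n : ℕ} {ν : Measure (EuclideanSpace ℝ (Fin n))}
    [IsProbabilityMeasure ν] {f : EuclideanSpace ℝ (Fin n) → ℝ} (hf : Measurable f)
    (hint : ∀ x, Integrable (fun t => f (x - t)) ν) {δ : ℝ≥0∞}
    (h : ∀ᵐ t ∂ν, eLpNorm (fun x => f (x - t) - f x) 2 volume ≤ δ) :
    eLpNorm (fun x => ∫ t, f (x - t) ∂ν - f x) 2 volume ≤ δ := by
  refine (ENNReal.pow_le_pow_left_iff two_ne_zero).1 ?_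
  rw [eLpNorm_two_sq]
  calc ∫⁻ x, ‖∫ t, f (x - t) ∂ν - f x‖ₑ ^ 2
      ≤ ∫⁻ x, ∫⁻ t, ‖f (x - t) - f x‖ₑ ^ 2 ∂ν := by
        refine lintegral_mono fun x => ?_
        have : ∫ t, f (x - t) ∂ν - f x = ∫ t, (f (x - t) - f x) ∂ν := by
          rw [integral_sub (hint x) (integrable_const _)]; simp
        rw [this]
        refine le_trans (pow_le_pow_left₀ zero_le
          (enorm_integral_le_lintegral_enorm _) 2) (sq_lintegral_le ?_)
        fun_prop
    _ = ∫⁻ t, (∫⁻ x, ‖f (x - t) - f x‖ₑ ^ 2) ∂ν := by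
        refine lintegral_lintegral_swap ?_
        simp only [Function.uncurry_def]
        fun_prop
    _ ≤ ∫⁻ t, δ ^ 2 ∂ν := by
        refine lintegral_mono_ae (h.mono fun t ht => ?_)
        rw [← eLpNorm_two_sq (fun x => f (x - t) - f x)]
        gcongr
    _ = δ ^ 2 := by simp

/-- Averages against a measure of density at most `c` inherit bounds from `L²(ℝⁿ)`. This covers both
uniform measures on balls and mollifiers. -/
lemma lintegral_translate_le {n : ℕ} {ν : Measure (EuclideanSpace ℝ (Fin n))} {c : ℝ≥0∞}
    (hν : ν ≤ c • volume) (f : EuclideanSpace ℝ (Fin n) → ℝ) (x : EuclideanSpace ℝ (Fin n)) :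
    ∫⁻ t, ‖f (x - t)‖ₑ ^ 2 ∂ν ≤ c * eLpNorm f 2 volume ^ 2 := by
  calc ∫⁻ t, ‖f (x - t)‖ₑ ^ 2 ∂ν ≤ ∫⁻ t, ‖f (x - t)‖ₑ ^ 2 ∂(c • volume) := lintegral_mono' hν le_rfl
    _ = c * ∫⁻ t, ‖f (x - t)‖ₑ ^ 2 := by rw [lintegral_smul_measure, smul_eq_mul]
    _ = _ := by
      rw [lintegral_sub_left_eq_self (fun t => ‖f t‖ₑ ^ 2) x, eLpNorm_two_sq]

lemma integrable_translate {n : ℕ} {ν : Measure (EuclideanSpace ℝ (Fin n))}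
    [IsProbabilityMeasure ν] {c : ℝ≥0∞} (hc : c ≠ ⊤) (hν : ν ≤ c • volume)
    {f : EuclideanSpace ℝ (Fin n) → ℝ} (hf : Measurable f) (hf2 : MemLp f 2 volume)
    (x : EuclideanSpace ℝ (Fin n)) : Integrable (fun t => f (x - t)) ν := by
  have : MemLp (fun t => f (x - t)) 2 ν := by
    refine ⟨Measurable.aestronglyMeasurable (by fun_prop), ?_⟩
    have h := (lintegral_translate_le hν f x).trans_lt
      (ENNReal.mul_lt_top hc.lt_top (ENNReal.pow_lt_top hf2.2))
    rw [← eLpNorm_two_sq (fun t => f (x - t))] at h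
    simpa using h
  exact this.integrable (by norm_num)

lemma enorm_average_sq_le {n : ℕ} {ν : Measure (EuclideanSpace ℝ (Fin n))}
    [IsProbabilityMeasure ν] {c : ℝ≥0∞} (hν : ν ≤ c • volume)
    {f : EuclideanSpace ℝ (Fin n) → ℝ} (hf : Measurable f)
    (x : EuclideanSpace ℝ (Fin n)) :
    ‖∫ t, f (x - t) ∂ν‖ₑ ^ 2 ≤ c * eLpNorm f 2 volume ^ 2 :=
  calc ‖∫ t, f (x - t) ∂ν‖ₑ ^ 2 ≤ (∫⁻ t, ‖f (x - t)‖ₑ ∂ν) ^ 2 :=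
        pow_le_pow_left₀ zero_le (enorm_integral_le_lintegral_enorm _) 2
    _ ≤ ∫⁻ t, ‖f (x - t)‖ₑ ^ 2 ∂ν := sq_lintegral_le (by fun_prop)
    _ ≤ _ := lintegral_translate_le hν f x

/-! ### Translation modulus of `C¹` functions. -/

lemma norm_fderiv_le_sum {n : ℕ} (φ : EuclideanSpace ℝ (Fin n) → ℝ)
    (x : EuclideanSpace ℝ (Fin n)) : ‖fderiv ℝ φ x‖ ≤ ∑ i, ‖partialDeriv i φ x‖ := by
  refine ContinuousLinearMap.opNorm_le_bound _ (by positivity) fun y => ?_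
  have hy : y = ∑ i, y i • EuclideanSpace.single i (1 : ℝ) := by
    ext j
    simp [Finset.sum_apply, Pi.single_apply]
  conv_lhs => rw [hy]
  rw [map_sum, Finset.sum_mul]
  refine (norm_sum_le _ _).trans (Finset.sum_le_sum fun i _ => ?_)
  rw [map_smul, norm_smul, mul_comm]
  exact mul_le_mul_of_nonneg_left (PiLp.norm_apply_le y i) (norm_nonneg _)

/-- The `L²` modulus of continuity of a `C¹` function is controlled by its gradient. -/
lemma eLpNorm_translate_sub_le {n : ℕ} {φ : EuclideanSpace ℝ (Fin n) → ℝ} (hφ : ContDiff ℝ 1 φ)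
    (y : EuclideanSpace ℝ (Fin n)) :
    eLpNorm (fun x => φ (x - y) - φ x) 2 volume ≤
      ‖y‖ₑ * ∑ i, eLpNorm (partialDeriv i φ) 2 volume := by
  have hc : Continuous (fderiv ℝ φ) := hφ.continuous_fderiv one_ne_zero
  have hpc : ∀ i, Continuous (partialDeriv i φ) := fun i => by
    unfold partialDeriv; fun_prop
  have key : eLpNorm (fun x => φ (x - y) - φ x) 2 volume ≤
      ‖y‖ₑ * eLpNorm (fderiv ℝ φ) 2 volume := by
    refine (ENNReal.pow_le_pow_left_iff two_ne_zero).1 ?_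
    rw [mul_pow, eLpNorm_two_sq, eLpNorm_two_sq]
    -- The increment is an integral along the segment from `x` to `x - y`; the unit parameter
    -- interval has mass one, so Jensen applies.
    have hprob : IsProbabilityMeasure (volume.restrict (Set.Ioc (0 : ℝ) 1)) := ⟨by simp⟩
    calc ∫⁻ x, ‖φ (x - y) - φ x‖ₑ ^ 2
        ≤ ∫⁻ x, ∫⁻ t in Set.Ioc (0 : ℝ) 1, ‖y‖ₑ ^ 2 * ‖fderiv ℝ φ (x - t • y)‖ₑ ^ 2 := by
          refine lintegral_mono fun x => ?_
          have hder : ∀ t : ℝ, HasDerivAt (fun t : ℝ => φ (x - t • y))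
              (fderiv ℝ φ (x - t • y) (-y)) t := fun t => by
            have h1 : HasDerivAt (fun t : ℝ => x - t • y) (-y) t := by
              simpa using ((hasDerivAt_id t).smul_const y).const_sub x
            exact ((hφ.differentiable one_ne_zero _).hasFDerivAt).comp_hasDerivAt t h1
          have hint := intervalIntegral.integral_eq_sub_of_hasDerivAt (a := 0) (b := 1)
            (fun t _ => hder t) (Continuous.intervalIntegrable (by fun_prop) _ _)
          simp only [one_smul, zero_smul, sub_zero] at hint
          rw [← hint, intervalIntegral.integral_of_le zero_le_one]
          calc _ ≤ (∫⁻ t in Set.Ioc (0 : ℝ) 1, ‖fderiv ℝ φ (x - t • y) (-y)‖ₑ) ^ 2 :=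
                pow_le_pow_left₀ zero_le (enorm_integral_le_lintegral_enorm _) 2
            _ ≤ ∫⁻ t in Set.Ioc (0 : ℝ) 1, ‖fderiv ℝ φ (x - t • y) (-y)‖ₑ ^ 2 := by
                refine sq_lintegral_le (Continuous.aemeasurable ?_)
                fun_prop
            _ ≤ _ := by
                refine lintegral_mono fun t => ?_
                rw [← mul_pow, mul_comm]
                refine pow_le_pow_left₀ zero_le ?_ 2
                simpa using (fderiv ℝ φ (x - t • y)).le_opENorm (-y)
      _ = ∫⁻ t in Set.Ioc (0 : ℝ) 1, ∫⁻ x, ‖y‖ₑ ^ 2 * ‖fderiv ℝ φ (x - t • y)‖ₑ ^ 2 := by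
          refine lintegral_lintegral_swap (Continuous.aemeasurable ?_)
          simp only [Function.uncurry_def]
          exact ENNReal.continuous_const_mul (by simp) |>.comp (by fun_prop)
      _ = ∫⁻ t in Set.Ioc (0 : ℝ) 1, ‖y‖ₑ ^ 2 * ∫⁻ x, ‖fderiv ℝ φ x‖ₑ ^ 2 := by
          refine lintegral_congr fun t => ?_
          rw [lintegral_const_mul' _ _ (by simp),
            lintegral_sub_right_eq_self (fun x => ‖fderiv ℝ φ x‖ₑ ^ 2)]
      _ = _ := by simp
  refine key.trans (mul_le_mul_right ?_ _)
  calc eLpNorm (fderiv ℝ φ) 2 volume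
      ≤ eLpNorm (fun x => ∑ i, ‖partialDeriv i φ x‖) 2 volume :=
        eLpNorm_mono_real fun x => norm_fderiv_le_sum φ x
    _ ≤ ∑ i, eLpNorm (fun x => ‖partialDeriv i φ x‖) 2 volume := by
        have := eLpNorm_sum_le (μ := volume) (p := 2) (s := Finset.univ)
          (f := fun i x => ‖partialDeriv i φ x‖)
          (fun i _ => (hpc i).norm.aestronglyMeasurable) (by norm_num)
        convert this using 2
        ext x; simp
    _ = _ := Finset.sum_congr rfl fun i _ => eLpNorm_norm _

/-! ### Truncation by ball averages. -/

/-- If `f` varies little in `L²` under translations by less than `ε`, then `f` is close in `L²` to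
its average over balls of radius `ε`, which is bounded. -/
lemma eLpNorm_truncation_le {n : ℕ} {f : EuclideanSpace ℝ (Fin n) → ℝ} (hf : MemLp f 2 volume)
    {S : ℝ≥0∞} (hS : ∀ y, eLpNorm (fun x => f (x - y) - f x) 2 volume ≤ ‖y‖ₑ * S)
    {ε K : ℝ} (hε : 0 < ε) (hK : 0 ≤ K)
    (hfK : eLpNorm f 2 volume ^ 2 ≤
      ENNReal.ofReal K ^ 2 * volume (Metric.ball (0 : EuclideanSpace ℝ (Fin n)) ε)) :
    eLpNorm (fun x => max (f x - K) 0) 2 volume ≤ ENNReal.ofReal ε * S := by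
  -- Tonelli needs joint measurability of `f (x - t)`. Changing `f` on a null set is harmless
  -- because translations preserve null sets.
  wlog hm : Measurable f generalizing f
  · obtain ⟨f', hf', hff'⟩ := hf.1.aemeasurable
    have h2 : eLpNorm f 2 volume = eLpNorm f' 2 volume := eLpNorm_congr_ae hff'
    have h3 := this (f := f') ((memLp_congr_ae hff').1 hf) (fun y => ?_) (h2 ▸ hfK) hf'
    · refine le_trans (eLpNorm_congr_ae ?_).le h3
      filter_upwards [hff'] with x hx
      rw [hx]
    · refine le_trans (eLpNorm_congr_ae ?_).le (hS y)
      filter_upwards [hff',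
        (measurePreserving_sub_right volume y).quasiMeasurePreserving.ae hff'] with x hx hx'
      rw [hx, hx']
  set B := Metric.ball (0 : EuclideanSpace ℝ (Fin n)) ε with hB
  have hB0 : volume B ≠ 0 := (Metric.measure_ball_pos volume _ hε).ne'
  have hBt : volume B ≠ ⊤ := measure_ball_lt_top.ne
  set ν : Measure (EuclideanSpace ℝ (Fin n)) := (volume B)⁻¹ • volume.restrict B with hν
  have hprob : IsProbabilityMeasure ν :=
    ⟨by simp [hν, ENNReal.inv_mul_cancel hB0 hBt]⟩
  have hνc : ν ≤ (volume B)⁻¹ • volume := by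
    refine Measure.le_iff.2 fun s _ => ?_
    simp only [hν, Measure.smul_apply, smul_eq_mul]
    gcongr
    exact Measure.restrict_le_self
  have hbd : ∀ x, |∫ t, f (x - t) ∂ν| ≤ K := fun x => by
    have h1 := enorm_average_sq_le hνc hm x
    have h2 : (volume B)⁻¹ * eLpNorm f 2 volume ^ 2 ≤ ENNReal.ofReal K ^ 2 :=
      calc _ ≤ (volume B)⁻¹ * (ENNReal.ofReal K ^ 2 * volume B) := by gcongr
        _ = _ := by rw [mul_comm, mul_assoc, ENNReal.mul_inv_cancel hB0 hBt, mul_one]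
    have h3 := (ENNReal.pow_le_pow_left_iff two_ne_zero).1 (h1.trans h2)
    rwa [← ofReal_norm, ENNReal.ofReal_le_ofReal_iff hK, Real.norm_eq_abs] at h3
  have hδ : ∀ᵐ t ∂ν, eLpNorm (fun x => f (x - t) - f x) 2 volume ≤ ENNReal.ofReal ε * S := by
    refine Measure.ae_smul_measure ?_ _
    filter_upwards [ae_restrict_mem Metric.isOpen_ball.measurableSet] with t ht
    refine (hS t).trans ?_
    gcongr
    rw [← ofReal_norm]
    exact ENNReal.ofReal_le_ofReal (by simpa [hB] using (Metric.mem_ball.1 ht).le)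
  refine le_trans (eLpNorm_mono fun x => ?_)
    (eLpNorm_average_sub_le hm (integrable_translate (by simpa using hB0) hνc hm hf) hδ)
  rw [Real.norm_eq_abs, Real.norm_eq_abs, abs_of_nonneg (le_max_right _ _)]
  refine max_le ?_ (abs_nonneg _)
  -- Since the average is at most `K`, `f - K ≤ f - average ≤ |average - f|`.
  have := (abs_le.1 (hbd x)).2
  have := neg_abs_le (∫ t, f (x - t) ∂ν - f x)
  linarith

/-! ### Mollification and approximation by test functions. -/

/-- The mollification of `f` by the bump function `ρ`. -/
noncomputable def mollify {n : ℕ} (ρ : ContDiffBump (0 : EuclideanSpace ℝ (Fin n)))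
    (f : EuclideanSpace ℝ (Fin n) → ℝ) : EuclideanSpace ℝ (Fin n) → ℝ :=
  ρ.normed volume ⋆[ContinuousLinearMap.lsmul ℝ ℝ, volume] f

lemma eLpNorm_mollify_sub_le {n : ℕ} (ρ : ContDiffBump (0 : EuclideanSpace ℝ (Fin n)))
    {f : EuclideanSpace ℝ (Fin n) → ℝ} (hf : MemLp f 2 volume) {δ : ℝ≥0∞}
    (h : ∀ t ∈ Metric.ball (0 : EuclideanSpace ℝ (Fin n)) ρ.rOut,
      eLpNorm (fun x => f (x - t) - f x) 2 volume ≤ δ) :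
    eLpNorm (fun x => mollify ρ f x - f x) 2 volume ≤ δ := by
  wlog hm : Measurable f generalizing f
  · obtain ⟨f', hf', hff'⟩ := hf.1.aemeasurable
    have h3 := this (f := f') ((memLp_congr_ae hff').1 hf) (fun t ht => ?_) hf'
    · refine le_trans (eLpNorm_congr_ae ?_).le h3
      have : mollify ρ f = mollify ρ f' := convolution_congr _ (EventuallyEq.refl _ _) hff'
      filter_upwards [hff'] with x hx
      rw [hx, this]
    · refine le_trans (eLpNorm_congr_ae ?_).le (h t ht)
      filter_upwards [hff',
        (measurePreserving_sub_right volume t).quasiMeasurePreserving.ae hff'] with x hx hx'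
      rw [hx, hx']
  set ψ := ρ.normed volume with hψ
  have hψm : Measurable fun x => ENNReal.ofReal (ψ x) := by
    have := (ρ.continuous_normed (μ := volume)).measurable
    fun_prop
  -- Mollification is averaging against a probability measure with bounded density, so the same
  -- Jensen argument applies as for balls.
  set ν : Measure (EuclideanSpace ℝ (Fin n)) := volume.withDensity fun x => ENNReal.ofReal (ψ x)
    with hν
  have hprob : IsProbabilityMeasure ν := ⟨by
    rw [hν, withDensity_apply _ MeasurableSet.univ, Measure.restrict_univ,
      ← ofReal_integral_eq_lintegral_ofReal ρ.integrable_normed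
        (Eventually.of_forall fun x => ρ.nonneg_normed x), ρ.integral_normed]
    simp⟩
  obtain ⟨C, hC⟩ : ∃ C : ℝ, ∀ x, ψ x ≤ C := ⟨_, ρ.normed_le_div_measure_closedBall_rIn volume⟩
  have hνc : ν ≤ ENNReal.ofReal C • volume := by
    rw [← withDensity_const]
    exact withDensity_mono (Eventually.of_forall fun x => ENNReal.ofReal_le_ofReal (hC x))
  have hδ : ∀ᵐ t ∂ν, eLpNorm (fun x => f (x - t) - f x) 2 volume ≤ δ := by
    rw [hν, ae_withDensity_iff hψm]
    refine Eventually.of_forall fun t ht => h t ?_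
    rw [← ρ.support_normed_eq (μ := volume)]
    intro h0
    exact ht (by rw [hψ, h0, ENNReal.ofReal_zero])
  have hmol : ∀ x, mollify ρ f x = ∫ t, f (x - t) ∂ν := fun x => by
    rw [hν, integral_withDensity_eq_integral_toReal_smul hψm (by simp)]
    refine integral_congr_ae (Eventually.of_forall fun t => ?_)
    simp [hψ, ENNReal.toReal_ofReal (ρ.nonneg_normed t)]
  simp_rw [hmol]
  exact eLpNorm_average_sub_le hm (integrable_translate (by simp) hνc hm hf) hδ

lemma tendsto_eLpNorm_mollify_sub {n : ℕ}
    {ρ : ℕ → ContDiffBump (0 : EuclideanSpace ℝ (Fin n))}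
    (hρ : Tendsto (fun k => (ρ k).rOut) atTop (𝓝 0))
    {f : EuclideanSpace ℝ (Fin n) → ℝ} (hf : MemLp f 2 volume) :
    Tendsto (fun k => eLpNorm (fun x => mollify (ρ k) f x - f x) 2 volume) atTop (𝓝 0) := by
  refine ENNReal.tendsto_nhds_zero.2 fun δ hδ => ?_
  obtain ⟨r, hr, hball⟩ := Metric.eventually_nhds_iff_ball.1
    (ENNReal.tendsto_nhds_zero.1 (tendsto_eLpNorm_translate_sub hf) δ hδ)
  filter_upwards [hρ.eventually_lt_const hr] with k hk
  exact eLpNorm_mollify_sub_le _ hf fun t ht => hball t (Metric.ball_subset_ball hk.le ht)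

lemma contDiff_mollify {n : ℕ} (ρ : ContDiffBump (0 : EuclideanSpace ℝ (Fin n)))
    {f : EuclideanSpace ℝ (Fin n) → ℝ} (hf : MemLp f 2 volume) : ContDiff ℝ ∞ (mollify ρ f) :=
  ρ.hasCompactSupport_normed.contDiff_convolution_left _ ρ.contDiff_normed
    (hf.locallyIntegrable (by norm_num))

/-- Differentiation falls on the kernel, and the weak identity is tested with `t ↦ ψ (x - t)`; the
sign from the reflection cancels the sign of the integration by parts. -/
lemma partialDeriv_mollify {n : ℕ} (ρ : ContDiffBump (0 : EuclideanSpace ℝ (Fin n)))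
    {f : EuclideanSpace ℝ (Fin n) → ℝ} {g : Fin n → EuclideanSpace ℝ (Fin n) → ℝ}
    (hf : MemLp f 2 volume)
    (hfg : ∀ φ, ContDiff ℝ ∞ φ → HasCompactSupport φ → ∀ i,
      ∫ x, f x * partialDeriv i φ x = - ∫ x, g i x * φ x) (i : Fin n) :
    partialDeriv i (mollify ρ f) = mollify ρ (g i) := by
  ext x
  set ψ := ρ.normed volume with hψ
  have hψs : ContDiff ℝ ∞ ψ := ρ.contDiff_normed
  have hψ1 : ContDiff ℝ 1 ψ := ρ.contDiff_normed (n := 1)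
  have hψc : HasCompactSupport ψ := ρ.hasCompactSupport_normed
  have hloc := hf.locallyIntegrable (by norm_num)
  have h1 : partialDeriv i (mollify ρ f) x =
      ∫ t, fderiv ℝ ψ (x - t) (EuclideanSpace.single i 1) * f t := by
    have hd := hψc.hasFDerivAt_convolution_left (ContinuousLinearMap.lsmul ℝ ℝ) hψ1 hloc x
    have hex := (hψc.fderiv (𝕜 := ℝ)).convolutionExists_left
      (ContinuousLinearMap.precompL (EuclideanSpace ℝ (Fin n)) (ContinuousLinearMap.lsmul ℝ ℝ))
      (hψ1.continuous_fderiv one_ne_zero) hloc x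
    rw [partialDeriv, mollify, hd.fderiv, convolution_eq_swap,
      ContinuousLinearMap.integral_apply hex.integrable_swap]
    simp [ContinuousLinearMap.precompL_apply]
  have h2 : mollify ρ (g i) x = ∫ t, ψ (x - t) * g i t := by
    rw [mollify, convolution_lsmul_swap]
    rfl
  have hcs : HasCompactSupport fun t => ψ (x - t) :=
    hψc.comp_homeomorph (Homeomorph.subLeft x)
  have h3 := hfg (fun t => ψ (x - t)) (by fun_prop) hcs i
  have h4 : ∀ t, partialDeriv i (fun t => ψ (x - t)) t =
      - fderiv ℝ ψ (x - t) (EuclideanSpace.single i 1) := fun t => by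
    have := (hψ1.differentiable one_ne_zero (x - t)).hasFDerivAt.comp t
      ((hasFDerivAt_id t).const_sub x)
    rw [partialDeriv, show (fun t => ψ (x - t)) = ψ ∘ HSub.hSub x from rfl, this.fderiv]
    simp
  rw [h1, h2]
  simp_rw [h4] at h3
  rw [← neg_inj, ← integral_neg]
  calc _ = ∫ t, f t * -fderiv ℝ ψ (x - t) (EuclideanSpace.single i 1) := by
        congr 1; ext t; ring
    _ = _ := by rw [h3]; congr 2; ext t; ring

lemma support_mollify_subset {n : ℕ} (ρ : ContDiffBump (0 : EuclideanSpace ℝ (Fin n)))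
    {f : EuclideanSpace ℝ (Fin n) → ℝ} {s : ℝ}
    (hf : Function.support f ⊆ Metric.closedBall 0 s) :
    Function.support (mollify ρ f) ⊆ Metric.closedBall 0 (ρ.rOut + s) := by
  refine (support_convolution_subset _).trans ?_
  rw [ρ.support_normed_eq]
  rintro _ ⟨a, ha, b, hb, rfl⟩
  have ha' := (mem_ball_zero_iff.1 ha).le
  have hb' := mem_closedBall_zero_iff.1 (hf hb)
  exact mem_closedBall_zero_iff.2 ((norm_add_le a b).trans (add_le_add ha' hb'))

/-- A function in `H¹(ℝⁿ)` that is supported in a ball is the `H¹`-limit of test functions in any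
larger ball. -/
lemma exists_testFunction_approx {n : ℕ} {f : EuclideanSpace ℝ (Fin n) → ℝ}
    {g : Fin n → EuclideanSpace ℝ (Fin n) → ℝ} (hf : MemLp f 2 volume)
    (hg : ∀ i, MemLp (g i) 2 volume)
    (hfg : ∀ φ, ContDiff ℝ ∞ φ → HasCompactSupport φ → ∀ i,
      ∫ x, f x * partialDeriv i φ x = - ∫ x, g i x * φ x) {s r : ℝ} (hsr : s < r)
    (hfs : Function.support f ⊆ Metric.closedBall 0 s) :
    ∃ φ : ℕ → EuclideanSpace ℝ (Fin n) → ℝ,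
      (∀ k, IsTestFunction (Metric.ball 0 r) (φ k)) ∧
      Tendsto (fun k => eLpNorm (fun x => φ k x - f x) 2 volume) atTop (𝓝 0) ∧
      ∀ i, Tendsto (fun k => eLpNorm (fun x => partialDeriv i (φ k) x - g i x) 2 volume)
        atTop (𝓝 0) := by
  have hd : 0 < r - s := sub_pos.2 hsr
  -- With `k + 2` the outer radius is below `r - s` already at `k = 0`, so every mollification is
  -- supported inside the ball of radius `r`.
  let ρ : ℕ → ContDiffBump (0 : EuclideanSpace ℝ (Fin n)) := fun k =>
    { rIn := (r - s) / (k + 3)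
      rOut := (r - s) / (k + 2)
      rIn_pos := by positivity
      rIn_lt_rOut := by gcongr; norm_num }
  have hρ : Tendsto (fun k => (ρ k).rOut) atTop (𝓝 0) :=
    tendsto_const_nhds.div_atTop (tendsto_atTop_add_const_right _ _ tendsto_natCast_atTop_atTop)
  refine ⟨fun k => mollify (ρ k) f, fun k => ?_, tendsto_eLpNorm_mollify_sub hρ hf, fun i => ?_⟩
  · have hsub := support_mollify_subset (ρ k) hfs
    refine ⟨contDiff_mollify _ hf, HasCompactSupport.of_support_subset_isCompact
      (isCompact_closedBall _ _) hsub,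
      (closure_minimal hsub Metric.isClosed_closedBall).trans
        (Metric.closedBall_subset_ball ?_)⟩
    have : (r - s) / ((k : ℝ) + 2) < r - s := div_lt_self hd (by linarith [k.cast_nonneg (α := ℝ)])
    change (r - s) / ((k : ℝ) + 2) + s < r
    linarith
  · simp_rw [partialDeriv_mollify _ hf hfg]
    exact tendsto_eLpNorm_mollify_sub hρ (hg i)

/-! ### Translation modulus of `H¹` functions, by approximation. -/

/-- The `L²` modulus of continuity of an `H¹` function is controlled by its weak gradient. -/
lemma eLpNorm_translate_sub_le_of_tendsto {n : ℕ} {f : EuclideanSpace ℝ (Fin n) → ℝ}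
    {g : Fin n → EuclideanSpace ℝ (Fin n) → ℝ} (hf : MemLp f 2 volume)
    (hg : ∀ i, MemLp (g i) 2 volume) {φ : ℕ → EuclideanSpace ℝ (Fin n) → ℝ}
    (hφ : ∀ k, ContDiff ℝ 1 (φ k))
    (hφf : Tendsto (fun k => eLpNorm (fun x => φ k x - f x) 2 volume) atTop (𝓝 0))
    (hφg : ∀ i, Tendsto (fun k => eLpNorm (fun x => partialDeriv i (φ k) x - g i x) 2 volume)
        atTop (𝓝 0)) (y : EuclideanSpace ℝ (Fin n)) :
    eLpNorm (fun x => f (x - y) - f x) 2 volume ≤ ‖y‖ₑ * ∑ i, eLpNorm (g i) 2 volume := by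
  set a := fun k => eLpNorm (fun x => φ k x - f x) 2 volume
  set b := fun i k => eLpNorm (fun x => partialDeriv i (φ k) x - g i x) 2 volume
  have hpc : ∀ k i, Continuous (partialDeriv i (φ k)) := fun k i => by
    have := (hφ k).continuous_fderiv one_ne_zero
    unfold partialDeriv; fun_prop
  have hmp := measurePreserving_sub_right (volume : Measure (EuclideanSpace ℝ (Fin n))) y
  have hbd : ∀ k, eLpNorm (fun x => f (x - y) - f x) 2 volume ≤
      (a k + ‖y‖ₑ * ∑ i, (b i k + eLpNorm (g i) 2 volume)) + a k := fun k => by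
    have hm1 : AEStronglyMeasurable (fun x => φ k x - f x) volume :=
      (hφ k).continuous.aestronglyMeasurable.sub hf.1
    have hm2 : AEStronglyMeasurable (fun x => φ k (x - y) - f (x - y)) volume :=
      hm1.comp_measurePreserving hmp
    have hm3 : AEStronglyMeasurable (fun x => φ k (x - y) - φ k x) volume := by
      have := (hφ k).continuous
      exact Continuous.aestronglyMeasurable (by fun_prop)
    have hsplit : (fun x => f (x - y) - f x) =
        (-(fun x => φ k (x - y) - f (x - y)) + fun x => φ k (x - y) - φ k x)
          + fun x => φ k x - f x := by
      ext x; simp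
    rw [hsplit]
    refine (eLpNorm_add_le (hm2.neg.add hm3) hm1 (by norm_num)).trans (add_le_add_left ?_ _)
    refine (eLpNorm_add_le hm2.neg hm3 (by norm_num)).trans (add_le_add ?_ ?_)
    · rw [eLpNorm_neg]
      exact (eLpNorm_comp_measurePreserving hm1 hmp).le
    · refine (eLpNorm_translate_sub_le (hφ k) y).trans (mul_le_mul_right ?_ _)
      refine Finset.sum_le_sum fun i _ => ?_
      have : partialDeriv i (φ k) = (fun x => partialDeriv i (φ k) x - g i x) + g i := by
        ext x; simp
      conv_lhs => rw [this]
      exact eLpNorm_add_le ((hpc k i).aestronglyMeasurable.sub (hg i).1) (hg i).1 (by norm_num)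
  have hlim : Tendsto (fun k => (a k + ‖y‖ₑ * ∑ i, (b i k + eLpNorm (g i) 2 volume)) + a k) atTop
      (𝓝 ((0 + ‖y‖ₑ * ∑ i, (0 + eLpNorm (g i) 2 volume)) + 0)) := by
    refine (hφf.add (ENNReal.Tendsto.const_mul ?_ (Or.inr (by simp)))).add hφf
    exact tendsto_finsetSum _ fun i _ => (hφg i).add_const _
  simpa using ge_of_tendsto' hlim hbd

/-! ### Cutoffs and localisation. -/

/-- Dilating one fixed bump makes the gradient bound scale exactly as `1 / r`. The radius 3/4 leaves
room for mollification inside the ball. -/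
lemma exists_cutoff (n : ℕ) : ∃ M : ℝ, 0 < M ∧ ∀ r : ℝ, 0 < r →
    ∃ η : EuclideanSpace ℝ (Fin n) → ℝ, ContDiff ℝ ∞ η ∧ (∀ x, 0 ≤ η x) ∧ (∀ x, η x ≤ 1) ∧
      (∀ x ∈ Metric.ball (0 : EuclideanSpace ℝ (Fin n)) (r / 2), η x = 1) ∧
      tsupport η ⊆ Metric.closedBall 0 (3 / 4 * r) ∧
      ∀ i x, |partialDeriv i η x| ≤ M / r := by
  let b : ContDiffBump (0 : EuclideanSpace ℝ (Fin n)) :=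
    { rIn := 1 / 2, rOut := 3 / 4, rIn_pos := by norm_num, rIn_lt_rOut := by norm_num }
  have hb : ContDiff ℝ ∞ b := b.contDiff
  obtain ⟨M, hM⟩ := (b.hasCompactSupport.fderiv (𝕜 := ℝ)).exists_bound_of_continuous
    (hb.continuous_fderiv (by simp))
  have hM0 : 0 ≤ M := (norm_nonneg _).trans (hM 0)
  -- `M` may vanish, and the constant must be positive.
  refine ⟨M + 1, by linarith, fun r hr => ⟨fun x => b (r⁻¹ • x), by fun_prop,
    fun x => b.nonneg, fun x => b.le_one, fun x hx => b.one_of_mem_closedBall ?_, ?_,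
    fun i x => ?_⟩⟩
  · rw [mem_ball_zero_iff] at hx
    rw [mem_closedBall_zero_iff, norm_smul, norm_inv, Real.norm_of_nonneg hr.le,
      inv_mul_le_iff₀ hr]
    change ‖x‖ ≤ r * (1 / 2)
    linarith
  · refine closure_minimal (fun x hx => ?_) Metric.isClosed_closedBall
    have h1 : r⁻¹ • x ∈ Function.support b := hx
    rw [b.support_eq, mem_ball_zero_iff, norm_smul, norm_inv, Real.norm_of_nonneg hr.le,
      inv_mul_lt_iff₀ hr] at h1
    change ‖x‖ < r * (3 / 4) at h1
    rw [mem_closedBall_zero_iff]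
    linarith
  · have h1 : HasFDerivAt (fun x : EuclideanSpace ℝ (Fin n) => r⁻¹ • x)
        (r⁻¹ • ContinuousLinearMap.id ℝ (EuclideanSpace ℝ (Fin n))) x :=
      (hasFDerivAt_id x).const_smul r⁻¹
    have h2 := ((hb.differentiable (by simp) (r⁻¹ • x)).hasFDerivAt.comp x h1).fderiv
    rw [partialDeriv, show (fun x => b (r⁻¹ • x)) = b ∘ fun x => r⁻¹ • x from rfl, h2]
    simp only [ContinuousLinearMap.comp_apply, _root_.smul_apply,
      ContinuousLinearMap.id_apply, map_smul, smul_eq_mul, abs_mul, abs_inv, abs_of_pos hr]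
    rw [inv_mul_eq_div]
    gcongr
    calc _ ≤ ‖fderiv ℝ b (r⁻¹ • x)‖ * ‖EuclideanSpace.single i (1 : ℝ)‖ :=
          (fderiv ℝ b (r⁻¹ • x)).le_opNorm _
      _ ≤ M * 1 := by gcongr; exacts [hM _, by simp]
      _ ≤ M + 1 := by linarith

lemma partialDeriv_mul {n : ℕ} {φ ψ : EuclideanSpace ℝ (Fin n) → ℝ} (hφ : ContDiff ℝ ∞ φ)
    (hψ : ContDiff ℝ ∞ ψ) (i : Fin n) (x : EuclideanSpace ℝ (Fin n)) :
    partialDeriv i (fun x => φ x * ψ x) x =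
      φ x * partialDeriv i ψ x + ψ x * partialDeriv i φ x := by
  have h := ((hφ.differentiable (by simp) x).hasFDerivAt.mul
    (hψ.differentiable (by simp) x).hasFDerivAt).fderiv
  rw [partialDeriv, show (fun x => φ x * ψ x) = φ * ψ from rfl, h]
  simp [partialDeriv]

lemma continuous_partialDeriv {n : ℕ} {φ : EuclideanSpace ℝ (Fin n) → ℝ} (hφ : ContDiff ℝ ∞ φ)
    (i : Fin n) : Continuous (partialDeriv i φ) := by
  have := hφ.continuous_fderiv (by simp)
  unfold partialDeriv; fun_prop

lemma tsupport_partialDeriv_subset {n : ℕ} (φ : EuclideanSpace ℝ (Fin n) → ℝ) (i : Fin n) :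
    tsupport (partialDeriv i φ) ⊆ tsupport φ := by
  refine closure_minimal (fun x hx => ?_) (isClosed_tsupport φ)
  refine support_fderiv_subset ℝ fun h => hx ?_
  simp [partialDeriv, h]

/-- Extension by zero of a product with a cutoff function. -/
lemma memLp_cutoff_mul {n : ℕ} {r s : ℝ} (hsr : s < r) {ζ v : EuclideanSpace ℝ (Fin n) → ℝ}
    (hζ : Continuous ζ) (hζs : tsupport ζ ⊆ Metric.closedBall 0 s)
    (hv : MemLp v 2 (volume.restrict (Metric.ball 0 r))) :
    MemLp (fun x => ζ x * v x) 2 volume := by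
  have hcs : HasCompactSupport ζ := (isCompact_closedBall _ _).of_isClosed_subset
    (isClosed_tsupport ζ) hζs
  obtain ⟨C, hC⟩ := hcs.exists_bound_of_continuous hζ
  have h1 : MemLp (fun x => ζ x * v x) 2 (volume.restrict (Metric.ball 0 r)) :=
    hv.of_le_mul (c := C) (hζ.aestronglyMeasurable.mul hv.1) (Eventually.of_forall fun x => by
      rw [norm_mul]; gcongr; exact hC x)
  rw [← memLp_indicator_iff_restrict Metric.isOpen_ball.measurableSet] at h1
  convert h1 using 1
  symm
  rw [Set.indicator_eq_self]
  intro x hx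
  exact Metric.closedBall_subset_ball hsr (hζs (subset_tsupport _ (left_ne_zero_of_mul hx)))

/-- The weak product rule for a cutoff function and an `H¹` function, tested on all of `ℝⁿ`. -/
lemma IsH1.cutoff_mul_weak_deriv {n : ℕ} {r s : ℝ} (hsr : s < r)
    {η u : EuclideanSpace ℝ (Fin n) → ℝ} {Du : Fin n → EuclideanSpace ℝ (Fin n) → ℝ}
    (hη : ContDiff ℝ ∞ η) (hηs : tsupport η ⊆ Metric.closedBall 0 s)
    (hu : IsH1 (Metric.ball 0 r) u Du) {φ : EuclideanSpace ℝ (Fin n) → ℝ}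
    (hφ : ContDiff ℝ ∞ φ) (hφc : HasCompactSupport φ) (i : Fin n) :
    ∫ x, η x * u x * partialDeriv i φ x =
      - ∫ x, (η x * Du i x + partialDeriv i η x * u x) * φ x := by
  set Ω := Metric.ball (0 : EuclideanSpace ℝ (Fin n)) r
  have hηΩ : tsupport η ⊆ Ω := hηs.trans (Metric.closedBall_subset_ball hsr)
  have hη0 : ∀ x ∉ Ω, η x = 0 := fun x hx => image_eq_zero_of_notMem_tsupport fun h => hx (hηΩ h)
  have hη1 : ∀ x ∉ Ω, partialDeriv i η x = 0 := fun x hx =>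
    image_eq_zero_of_notMem_tsupport fun h => hx (hηΩ (tsupport_partialDeriv_subset η i h))
  have hint : ∀ {v ψ : EuclideanSpace ℝ (Fin n) → ℝ}, MemLp v 2 (volume.restrict Ω) →
      Continuous ψ → HasCompactSupport ψ → Integrable (fun x => v x * ψ x) (volume.restrict Ω) :=
    fun hv hψ hψc => hv.integrable_mul ((hψ.memLp_of_hasCompactSupport (p := 2) hψc).restrict Ω)
  -- The product rule results from testing the weak derivative of `u` with `η φ`, which is
  -- admissible in the ball though `φ` alone may not be.
  have hηφ : IsTestFunction Ω (fun x => η x * φ x) :=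
    ⟨hη.mul hφ, hφc.mul_left, (tsupport_mul_subset_left).trans hηΩ⟩
  have key := hu.weak_deriv _ hηφ i
  have e1 : ∫ x, η x * u x * partialDeriv i φ x = ∫ x in Ω, η x * u x * partialDeriv i φ x :=
    (setIntegral_eq_integral_of_forall_compl_eq_zero fun x hx => by simp [hη0 x hx]).symm
  have e2 : ∫ x, (η x * Du i x + partialDeriv i η x * u x) * φ x =
      ∫ x in Ω, (η x * Du i x + partialDeriv i η x * u x) * φ x :=
    (setIntegral_eq_integral_of_forall_compl_eq_zero fun x hx => by
      simp [hη0 x hx, hη1 x hx]).symm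
  rw [e1, e2]
  have hcη := hη.continuous
  have hcφ := hφ.continuous
  have hcη' := continuous_partialDeriv hη i
  have i1 : Integrable (fun x => u x * partialDeriv i (fun x => η x * φ x) x)
      (volume.restrict Ω) :=
    hint hu.memLp (continuous_partialDeriv hηφ.smooth i)
      (hηφ.hasCompactSupport.of_isClosed_subset (isClosed_tsupport _)
        (tsupport_partialDeriv_subset _ i))
  have i2 : Integrable (fun x => u x * (partialDeriv i η x * φ x)) (volume.restrict Ω) :=
    hint hu.memLp (hcη'.mul hcφ) hφc.mul_left
  have i3 : Integrable (fun x => Du i x * (η x * φ x)) (volume.restrict Ω) :=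
    hint (hu.memLp_deriv i) (hcη.mul hcφ) hφc.mul_left
  calc _ = ∫ x in Ω, (u x * partialDeriv i (fun x => η x * φ x) x
          - u x * (partialDeriv i η x * φ x)) := by
        congr 1; ext x; rw [partialDeriv_mul hη hφ]; ring
    _ = - (∫ x in Ω, Du i x * (η x * φ x)) - ∫ x in Ω, u x * (partialDeriv i η x * φ x) := by
        rw [integral_sub i1 i2, key]
    _ = - ∫ x in Ω, (Du i x * (η x * φ x) + u x * (partialDeriv i η x * φ x)) := by
        rw [integral_add i3 i2]; ring
    _ = _ := by
        congr 2; ext x; ring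

lemma IsH1.memLp_cutoff_mul_deriv {n : ℕ} {r s : ℝ} (hsr : s < r)
    {η u : EuclideanSpace ℝ (Fin n) → ℝ} {Du : Fin n → EuclideanSpace ℝ (Fin n) → ℝ}
    (hη : ContDiff ℝ ∞ η) (hηs : tsupport η ⊆ Metric.closedBall 0 s)
    (hu : IsH1 (Metric.ball 0 r) u Du) (i : Fin n) :
    MemLp (fun x => η x * Du i x + partialDeriv i η x * u x) 2 volume :=
  (memLp_cutoff_mul hsr hη.continuous hηs (hu.memLp_deriv i)).add
    (memLp_cutoff_mul hsr (continuous_partialDeriv hη i)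
      ((tsupport_partialDeriv_subset η i).trans hηs) hu.memLp)

/-- The convergence is on all of `ℝⁿ`, which the translation estimate needs; `H¹₀` membership
follows by restriction. -/
lemma IsH1.cutoff_mul_approx {n : ℕ} {r s : ℝ} (hsr : s < r)
    {η u : EuclideanSpace ℝ (Fin n) → ℝ} {Du : Fin n → EuclideanSpace ℝ (Fin n) → ℝ}
    (hη : ContDiff ℝ ∞ η) (hηs : tsupport η ⊆ Metric.closedBall 0 s)
    (hu : IsH1 (Metric.ball 0 r) u Du) :
    ∃ φ : ℕ → EuclideanSpace ℝ (Fin n) → ℝ,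
      (∀ k, IsTestFunction (Metric.ball 0 r) (φ k)) ∧
      Tendsto (fun k => eLpNorm (fun x => φ k x - η x * u x) 2 volume) atTop (𝓝 0) ∧
      ∀ i, Tendsto (fun k => eLpNorm (fun x => partialDeriv i (φ k) x -
        (η x * Du i x + partialDeriv i η x * u x)) 2 volume) atTop (𝓝 0) :=
  exists_testFunction_approx (f := fun x => η x * u x)
    (g := fun i x => η x * Du i x + partialDeriv i η x * u x)
    (memLp_cutoff_mul hsr hη.continuous hηs hu.memLp)
    (hu.memLp_cutoff_mul_deriv hsr hη hηs)
    (fun _ hφ hφc i => hu.cutoff_mul_weak_deriv hsr hη hηs hφ hφc i) hsr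
    (fun _ hx => hηs (subset_tsupport _ (left_ne_zero_of_mul hx)))

/-- The product of a cutoff function and an `H¹` function is in `H¹₀`. -/
lemma IsH1.cutoff_mul {n : ℕ} {r s : ℝ} (hsr : s < r)
    {η u : EuclideanSpace ℝ (Fin n) → ℝ} {Du : Fin n → EuclideanSpace ℝ (Fin n) → ℝ}
    (hη : ContDiff ℝ ∞ η) (hηs : tsupport η ⊆ Metric.closedBall 0 s)
    (hu : IsH1 (Metric.ball 0 r) u Du) :
    IsH10 (Metric.ball 0 r) (fun x => η x * u x)
      (fun i x => η x * Du i x + partialDeriv i η x * u x) := by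
  obtain ⟨φ, hφ, hφ0, hφ1⟩ := hu.cutoff_mul_approx hsr hη hηs
  refine ⟨⟨(memLp_cutoff_mul hsr hη.continuous hηs hu.memLp).restrict _,
    fun i => (hu.memLp_cutoff_mul_deriv hsr hη hηs i).restrict _, fun ψ hψ i => ?_⟩, φ, hφ,
    tendsto_of_tendsto_of_tendsto_of_le_of_le tendsto_const_nhds hφ0 (fun _ => zero_le)
      (fun _ => eLpNorm_mono_measure _ Measure.restrict_le_self),
    fun i => tendsto_of_tendsto_of_tendsto_of_le_of_le tendsto_const_nhds (hφ1 i)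
      (fun _ => zero_le) (fun _ => eLpNorm_mono_measure _ Measure.restrict_le_self)⟩
  have hz : ∀ x ∉ Metric.ball (0 : EuclideanSpace ℝ (Fin n)) r, ψ x = 0 := fun x hx =>
    image_eq_zero_of_notMem_tsupport fun h => hx (hψ.tsupport_subset h)
  have hz' : ∀ x ∉ Metric.ball (0 : EuclideanSpace ℝ (Fin n)) r, partialDeriv i ψ x = 0 :=
    fun x hx => image_eq_zero_of_notMem_tsupport fun h =>
      hx (hψ.tsupport_subset (tsupport_partialDeriv_subset ψ i h))
  rw [setIntegral_eq_integral_of_forall_compl_eq_zero (fun x hx => by simp [hz' x hx]),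
    setIntegral_eq_integral_of_forall_compl_eq_zero (fun x hx => by simp [hz x hx])]
  exact hu.cutoff_mul_weak_deriv hsr hη hηs hψ.smooth hψ.hasCompactSupport i

/-! ### Caccioppoli and energy estimates. -/

lemma ofReal_integral_sq {α : Type*} [MeasurableSpace α] {μ : Measure α} {f : α → ℝ}
    (hf : MemLp f 2 μ) : ENNReal.ofReal (∫ x, f x ^ 2 ∂μ) = eLpNorm f 2 μ ^ 2 := by
  rw [ofReal_integral_eq_lintegral_ofReal hf.integrable_sq
    (Eventually.of_forall fun x => sq_nonneg _), eLpNorm_two_sq]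
  refine lintegral_congr fun x => ?_
  rw [← ofReal_norm, ← ENNReal.ofReal_pow (norm_nonneg _), Real.norm_eq_abs, sq_abs]

/-- Young's inequality for a bounded bilinear form. -/
lemma abs_bilin_le {n : ℕ} {Lam t : ℝ} (hL : 0 ≤ Lam) (ht : 0 < t) {a : Matrix (Fin n) (Fin n) ℝ}
    (ha : ∀ i j, |a i j| ≤ Lam) (X Y : Fin n → ℝ) :
    2 * |∑ i, ∑ j, a i j * X i * Y j| ≤ Lam * n * (t * ∑ i, X i ^ 2 + t⁻¹ * ∑ j, Y j ^ 2) := by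
  have hterm : ∀ i j, 2 * |a i j * X i * Y j| ≤ Lam * (t * X i ^ 2 + t⁻¹ * Y j ^ 2) := by
    intro i j
    have h1 : 2 * (|X i| * |Y j|) ≤ t * X i ^ 2 + t⁻¹ * Y j ^ 2 := by
      have h : 0 ≤ t⁻¹ * (t * |X i| - |Y j|) ^ 2 := by positivity
      have e : t⁻¹ * (t * |X i| - |Y j|) ^ 2 =
          t * |X i| ^ 2 + t⁻¹ * |Y j| ^ 2 - 2 * (|X i| * |Y j|) := by
        field_simp; ring
      rw [e, sq_abs, sq_abs] at h
      linarith
    rw [abs_mul, abs_mul]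
    calc 2 * (|a i j| * |X i| * |Y j|) = |a i j| * (2 * (|X i| * |Y j|)) := by ring
      _ ≤ Lam * (t * X i ^ 2 + t⁻¹ * Y j ^ 2) :=
        mul_le_mul (ha i j) h1 (by positivity) hL
  calc 2 * |∑ i, ∑ j, a i j * X i * Y j| ≤ 2 * ∑ i, ∑ j, |a i j * X i * Y j| := by
        gcongr
        exact (Finset.abs_sum_le_sum_abs _ _).trans
          (Finset.sum_le_sum fun i _ => Finset.abs_sum_le_sum_abs _ _)
    _ = ∑ i, ∑ j, 2 * |a i j * X i * Y j| := by simp_rw [Finset.mul_sum]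
    _ ≤ ∑ i, ∑ j, Lam * (t * X i ^ 2 + t⁻¹ * Y j ^ 2) :=
        Finset.sum_le_sum fun i _ => Finset.sum_le_sum fun j _ => hterm i j
    _ = _ := by
        simp only [mul_add, Finset.sum_add_distrib, Finset.sum_const, Finset.card_univ,
          Fintype.card_fin, nsmul_eq_mul, Finset.mul_sum]
        congr 1 <;> exact Finset.sum_congr rfl fun i _ => by ring

/-- The pointwise inequality behind the Caccioppoli estimate. -/
lemma caccioppoli_pointwise {n : ℕ} (hn : 1 ≤ n) {lam Lam M : ℝ} (hlam : 0 < lam) (hLam : lam ≤ Lam)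
    {a : Matrix (Fin n) (Fin n) ℝ}
    (hlow : ∀ ξ : EuclideanSpace ℝ (Fin n), lam * ‖ξ‖ ^ 2 ≤ ∑ i, ∑ j, a i j * ξ i * ξ j)
    (ha : ∀ i j, |a i j| ≤ Lam) (p d : Fin n → ℝ) (η u : ℝ) (hd : ∀ i, |d i| ≤ M) :
    lam / 2 * ∑ i, (η * p i) ^ 2 ≤
      (∑ i, ∑ j, a i j * p i * (η * η * p j + (η * d j + η * d j) * u)) +
        2 * Lam ^ 2 * n ^ 3 * M ^ 2 / lam * u ^ 2 := by
  have hL : 0 < Lam := hlam.trans_le hLam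
  have hn' : (0 : ℝ) < n := by exact_mod_cast hn
  have h1 := hlow (WithLp.toLp 2 fun i => η * p i)
  rw [EuclideanSpace.real_norm_sq_eq] at h1
  -- This `t` makes `Lam * n * t = lam / 2`, so half of the elliptic term absorbs the gradient part
  -- of the cross term.
  have h2 := abs_bilin_le hL.le (t := lam / (2 * Lam * n)) (by positivity) ha
    (fun i => η * p i) (fun j => d j * u)
  have h3 : ∑ j, (d j * u) ^ 2 ≤ n * M ^ 2 * u ^ 2 := by
    calc ∑ j, (d j * u) ^ 2 ≤ ∑ j : Fin n, M ^ 2 * u ^ 2 := by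
          refine Finset.sum_le_sum fun j _ => ?_
          rw [mul_pow]
          exact mul_le_mul_of_nonneg_right (sq_le_sq.2 ((hd j).trans (le_abs_self M))) (sq_nonneg _)
      _ = _ := by simp; ring
  have h4 : ∑ i, ∑ j, a i j * p i * (η * η * p j + (η * d j + η * d j) * u) =
      (∑ i, ∑ j, a i j * (η * p i) * (η * p j)) +
        2 * ∑ i, ∑ j, a i j * (η * p i) * (d j * u) := by
    simp only [Finset.mul_sum, ← Finset.sum_add_distrib]
    exact Finset.sum_congr rfl fun i _ => Finset.sum_congr rfl fun j _ => by ring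
  have h5 := neg_abs_le (∑ i, ∑ j, a i j * (η * p i) * (d j * u))
  have h6 : Lam * n * (lam / (2 * Lam * n) * ∑ i, (η * p i) ^ 2 +
      (lam / (2 * Lam * n))⁻¹ * ∑ j, (d j * u) ^ 2) ≤ lam / 2 * ∑ i, (η * p i) ^ 2 +
        2 * Lam ^ 2 * n ^ 3 * M ^ 2 / lam * u ^ 2 := by
    calc _ ≤ Lam * n * (lam / (2 * Lam * n) * ∑ i, (η * p i) ^ 2 +
          (lam / (2 * Lam * n))⁻¹ * (n * M ^ 2 * u ^ 2)) := by gcongr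
      _ = _ := by field_simp
  simp only at h1 h2
  rw [h4]
  linarith

/-- The Caccioppoli estimate. -/
lemma caccioppoli {n : ℕ} (hn : 1 ≤ n) {lam Lam r s M : ℝ} (hlam : 0 < lam) (hLam : lam ≤ Lam)
    (hsr : s < r) {a : EuclideanSpace ℝ (Fin n) → Matrix (Fin n) (Fin n) ℝ}
    (ha : IsUniformlyElliptic lam Lam (Metric.ball 0 r) a)
    {u : EuclideanSpace ℝ (Fin n) → ℝ} {Du : Fin n → EuclideanSpace ℝ (Fin n) → ℝ}
    (hu : IsH1 (Metric.ball 0 r) u Du)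
    (hsub : ∀ (v : EuclideanSpace ℝ (Fin n) → ℝ) (Dv : Fin n → EuclideanSpace ℝ (Fin n) → ℝ),
      IsH10 (Metric.ball 0 r) v Dv → (∀ᵐ x ∂(volume.restrict (Metric.ball 0 r)), 0 ≤ v x) →
        ∫ x in Metric.ball 0 r, ∑ i, ∑ j, a x i j * Du i x * Dv j x ≤ 0)
    (hu0 : ∀ᵐ x ∂(volume.restrict (Metric.ball (0 : EuclideanSpace ℝ (Fin n)) r)), 0 ≤ u x)
    {η : EuclideanSpace ℝ (Fin n) → ℝ} (hη : ContDiff ℝ ∞ η)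
    (hηs : tsupport η ⊆ Metric.closedBall 0 s) (hηM : ∀ i x, |partialDeriv i η x| ≤ M) :
    ∫ x in Metric.ball 0 r, ∑ i, (η x * Du i x) ^ 2 ≤
      4 * Lam ^ 2 * n ^ 3 * M ^ 2 / lam ^ 2 * ∫ x in Metric.ball 0 r, u x ^ 2 := by
  set Ω := Metric.ball (0 : EuclideanSpace ℝ (Fin n)) r
  -- The test function is `η² u`.
  have hη2 : ContDiff ℝ ∞ fun x => η x * η x := hη.mul hη
  have hη2s : tsupport (fun x => η x * η x) ⊆ Metric.closedBall 0 s :=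
    tsupport_mul_subset_left.trans hηs
  have hv := hu.cutoff_mul hsr hη2 hη2s
  have hle := hsub _ _ hv (hu0.mono fun x hx => mul_nonneg (mul_self_nonneg _) hx)
  simp_rw [partialDeriv_mul hη hη] at hle
  have hDv := hv.isH1.memLp_deriv
  simp_rw [partialDeriv_mul hη hη] at hDv
  set F : EuclideanSpace ℝ (Fin n) → ℝ := fun x => ∑ i, ∑ j, a x i j * Du i x *
    (η x * η x * Du j x + (η x * partialDeriv j η x + η x * partialDeriv j η x) * u x) with hF
  have hFi : Integrable F (volume.restrict Ω) := by
    refine integrable_finsetSum _ fun i _ => integrable_finsetSum _ fun j _ => ?_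
    simp_rw [mul_assoc (a _ i j)]
    exact ((hu.memLp_deriv i).integrable_mul (hDv j)).bdd_mul
      (ha.aemeasurable i j).aestronglyMeasurable (c := Lam) (ha.bound.mono fun x hx => hx i j)
  have hXi : Integrable (fun x => ∑ i, (η x * Du i x) ^ 2) (volume.restrict Ω) :=
    integrable_finsetSum _ fun i _ =>
      ((memLp_cutoff_mul hsr hη.continuous hηs (hu.memLp_deriv i)).restrict Ω).integrable_sq
  have hui : Integrable (fun x => u x ^ 2) (volume.restrict Ω) := hu.memLp.integrable_sq
  have hmain : ∫ x in Ω, lam / 2 * ∑ i, (η x * Du i x) ^ 2 ≤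
      ∫ x in Ω, (F x + 2 * Lam ^ 2 * n ^ 3 * M ^ 2 / lam * u x ^ 2) := by
    refine integral_mono_ae (hXi.const_mul _) (hFi.add (hui.const_mul _)) ?_
    filter_upwards [ha.lower, ha.bound] with x h1 h2
    exact caccioppoli_pointwise hn hlam hLam h1 h2 (fun i => Du i x)
      (fun i => partialDeriv i η x) (η x) (u x) fun i => hηM i x
  rw [integral_const_mul, integral_add hFi (hui.const_mul _), integral_const_mul] at hmain
  have h := hmain.trans (add_le_add_left hle _)
  rw [zero_add] at h
  have h2 := mul_le_mul_of_nonneg_left h (show 0 ≤ 2 / lam by positivity)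
  calc _ = 2 / lam * (lam / 2 * ∫ x in Ω, ∑ i, (η x * Du i x) ^ 2) := by field_simp
    _ ≤ _ := h2
    _ = _ := by field_simp; ring

/-- The energy bound for the product of a cutoff function and a nonnegative subsolution. -/
lemma exists_energy_bound {n : ℕ} (hn : 1 ≤ n) {lam Lam : ℝ} (hlam : 0 < lam) (hLam : lam ≤ Lam) :
    ∃ C : ℝ, 0 ≤ C ∧ ∀ {r s M : ℝ}, 0 ≤ M → s < r →
    ∀ {a : EuclideanSpace ℝ (Fin n) → Matrix (Fin n) (Fin n) ℝ},
    IsUniformlyElliptic lam Lam (Metric.ball 0 r) a →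
    ∀ {u : EuclideanSpace ℝ (Fin n) → ℝ} {Du : Fin n → EuclideanSpace ℝ (Fin n) → ℝ},
    IsH1 (Metric.ball 0 r) u Du →
    (∀ (v : EuclideanSpace ℝ (Fin n) → ℝ) (Dv : Fin n → EuclideanSpace ℝ (Fin n) → ℝ),
      IsH10 (Metric.ball 0 r) v Dv → (∀ᵐ x ∂(volume.restrict (Metric.ball 0 r)), 0 ≤ v x) →
        ∫ x in Metric.ball 0 r, ∑ i, ∑ j, a x i j * Du i x * Dv j x ≤ 0) →
    (∀ᵐ x ∂(volume.restrict (Metric.ball (0 : EuclideanSpace ℝ (Fin n)) r)), 0 ≤ u x) →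
    ∀ {η : EuclideanSpace ℝ (Fin n) → ℝ}, ContDiff ℝ ∞ η →
    tsupport η ⊆ Metric.closedBall 0 s → (∀ i x, |partialDeriv i η x| ≤ M) →
    ∑ i, eLpNorm (fun x => η x * Du i x + partialDeriv i η x * u x) 2 volume ≤
      ENNReal.ofReal (C * M) * eLpNorm u 2 (volume.restrict (Metric.ball 0 r)) := by
  set C₁ : ℝ := 4 * Lam ^ 2 * n ^ 3 / lam ^ 2 with hC₁
  have hC₁0 : 0 ≤ C₁ := by positivity
  -- From `(a + b)² ≤ 2a² + 2b²`: `2 C₁` comes from Caccioppoli, `2` from the term with `D_i η`, and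
  -- `n` from summing over `i`.
  refine ⟨n * √(2 * C₁ + 2), by positivity, ?_⟩
  intro r s M hM hsr a ha u Du hu hsub hu0 η hη hηs hηM
  set Ω := Metric.ball (0 : EuclideanSpace ℝ (Fin n)) r
  have hcac := caccioppoli hn hlam hLam hsr ha hu hsub hu0 hη hηs hηM
  have hui : Integrable (fun x => u x ^ 2) (volume.restrict Ω) := hu.memLp.integrable_sq
  have hXi : ∀ i, Integrable (fun x => (η x * Du i x) ^ 2) (volume.restrict Ω) := fun i =>
    ((memLp_cutoff_mul hsr hη.continuous hηs (hu.memLp_deriv i)).restrict Ω).integrable_sq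
  have hbd : ∀ i, eLpNorm (fun x => η x * Du i x + partialDeriv i η x * u x) 2 volume ≤
      ENNReal.ofReal (√(2 * C₁ + 2) * M) * eLpNorm u 2 (volume.restrict Ω) := fun i => by
    have hg := hu.memLp_cutoff_mul_deriv hsr hη hηs i
    refine (ENNReal.pow_le_pow_left_iff two_ne_zero).1 ?_
    rw [mul_pow, ← ofReal_integral_sq hg, ← ofReal_integral_sq hu.memLp,
      ← ENNReal.ofReal_pow (by positivity), ← ENNReal.ofReal_mul (by positivity)]
    refine ENNReal.ofReal_le_ofReal ?_
    rw [← setIntegral_eq_integral_of_forall_compl_eq_zero (s := Ω) fun x hx => ?_]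
    · have hle : ∫ x in Ω, (η x * Du i x + partialDeriv i η x * u x) ^ 2 ≤
          ∫ x in Ω, (2 * (∑ i, (η x * Du i x) ^ 2) + 2 * M ^ 2 * u x ^ 2) := by
        refine integral_mono (hg.restrict Ω).integrable_sq
          (((integrable_finsetSum _ fun i _ => hXi i).const_mul 2).add (hui.const_mul _))
          fun x => ?_
        have h1 : (η x * Du i x) ^ 2 ≤ ∑ i, (η x * Du i x) ^ 2 :=
          Finset.single_le_sum (f := fun i => (η x * Du i x) ^ 2)
            (fun i _ => sq_nonneg _) (Finset.mem_univ i)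
        have h2 : (partialDeriv i η x * u x) ^ 2 ≤ M ^ 2 * u x ^ 2 := by
          rw [mul_pow]
          exact mul_le_mul_of_nonneg_right (sq_le_sq.2 ((hηM i x).trans (le_abs_self M))) (sq_nonneg _)
        have h3 := add_sq_le (a := η x * Du i x) (b := partialDeriv i η x * u x)
        simp only
        linarith
      rw [integral_add ((integrable_finsetSum _ fun i _ => hXi i).const_mul 2)
        (hui.const_mul _), integral_const_mul, integral_const_mul] at hle
      rw [mul_pow, Real.sq_sqrt (by positivity)]
      calc _ ≤ _ := hle
        _ ≤ 2 * (4 * Lam ^ 2 * n ^ 3 * M ^ 2 / lam ^ 2 * ∫ x in Ω, u x ^ 2) +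
            2 * M ^ 2 * ∫ x in Ω, u x ^ 2 := by gcongr
        _ = _ := by rw [hC₁]; ring
    · have hx' : x ∉ tsupport η := fun h => hx (Metric.closedBall_subset_ball hsr (hηs h))
      simp [image_eq_zero_of_notMem_tsupport hx',
        image_eq_zero_of_notMem_tsupport fun h => hx' (tsupport_partialDeriv_subset η i h)]
  calc _ ≤ ∑ i : Fin n, ENNReal.ofReal (√(2 * C₁ + 2) * M) * eLpNorm u 2 (volume.restrict Ω) :=
        Finset.sum_le_sum fun i _ => hbd i
    _ = _ := by
        rw [Finset.sum_const, Finset.card_univ, Fintype.card_fin, nsmul_eq_mul, ← mul_assoc,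
          ← ENNReal.ofReal_natCast, ← ENNReal.ofReal_mul (by positivity), mul_assoc (n : ℝ)]

/-! ### Scale-invariant truncation estimate. -/

lemma measureReal_ball_mul {n : ℕ} {δ : ℝ} (hδ : 0 < δ) (r : ℝ) :
    volume.real (Metric.ball (0 : EuclideanSpace ℝ (Fin n)) (δ * r)) =
      δ ^ n * volume.real (Metric.ball (0 : EuclideanSpace ℝ (Fin n)) r) := by
  rw [measureReal_def, Measure.addHaar_ball_mul_of_pos _ _ hδ, ENNReal.toReal_mul,
    ENNReal.toReal_ofReal (by positivity), finrank_euclideanSpace_fin, measureReal_def]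

/-- The truncation of a nonnegative subsolution at a high level has small `L²` norm. -/
lemma exists_integral_truncation_le {n : ℕ} (hn : 1 ≤ n) {lam Lam : ℝ} (hlam : 0 < lam)
    (hLam : lam ≤ Lam) :
    ∃ D : ℝ, 0 ≤ D ∧ ∀ {r δ K : ℝ}, 0 < r → 0 < δ → 0 ≤ K →
    ∀ {a : EuclideanSpace ℝ (Fin n) → Matrix (Fin n) (Fin n) ℝ},
    IsUniformlyElliptic lam Lam (Metric.ball 0 r) a →
    ∀ {u : EuclideanSpace ℝ (Fin n) → ℝ}, IsSubsolution a (Metric.ball 0 r) u →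
    (∀ᵐ x ∂(volume.restrict (Metric.ball (0 : EuclideanSpace ℝ (Fin n)) r)), 0 ≤ u x) →
    ∫ x in Metric.ball 0 r, u x ^ 2 ≤
      K ^ 2 * volume.real (Metric.ball (0 : EuclideanSpace ℝ (Fin n)) (δ * r)) →
    ∫ x in Metric.ball 0 (r / 2), max (u x - K) 0 ^ 2 ≤
      (δ * D) ^ 2 * ∫ x in Metric.ball 0 r, u x ^ 2 := by
  obtain ⟨M, hM, hcut⟩ := exists_cutoff n
  obtain ⟨C, hC, henergy⟩ := exists_energy_bound hn hlam hLam
  -- The averaging radius `δ r` cancels the factor `1 / r` in the cutoff gradient, so `D` is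
  -- independent of `r`.
  refine ⟨C * M, by positivity, ?_⟩
  intro r δ K hr hδ hK a ha u ⟨Du, hu, hsub⟩ hu0 hJ
  obtain ⟨η, hη, hη0, hη1, hηone, hηs, hηM⟩ := hcut r hr
  have hsr : 3 / 4 * r < r := by linarith
  set Ω := Metric.ball (0 : EuclideanSpace ℝ (Fin n)) r with hΩ
  have hen := henergy (by positivity) hsr ha hu hsub hu0 hη hηs hηM
  obtain ⟨φ, hφ, hφ0, hφ1⟩ := hu.cutoff_mul_approx hsr hη hηs
  have hw := memLp_cutoff_mul hsr hη.continuous hηs hu.memLp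
  have htrans := eLpNorm_translate_sub_le_of_tendsto hw (hu.memLp_cutoff_mul_deriv hsr hη hηs)
    (fun k => (hφ k).smooth.of_le (by norm_num)) hφ0 hφ1
  have hwu : eLpNorm (fun x => η x * u x) 2 volume ≤ eLpNorm u 2 (volume.restrict Ω) := by
    rw [← eLpNorm_restrict_eq_of_support_subset (s := Ω) fun x hx =>
      Metric.closedBall_subset_ball hsr (hηs (subset_tsupport _ (left_ne_zero_of_mul hx)))]
    refine eLpNorm_mono fun x => ?_
    rw [norm_mul, Real.norm_of_nonneg (hη0 x)]
    exact mul_le_of_le_one_left (norm_nonneg _) (hη1 x)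
  have htr := eLpNorm_truncation_le hw htrans (mul_pos hδ hr) hK (by
    calc _ ≤ eLpNorm u 2 (volume.restrict Ω) ^ 2 := by gcongr
      _ ≤ _ := by
        rw [← ofReal_integral_sq hu.memLp, ← ENNReal.ofReal_pow hK,
          ← ofReal_measureReal measure_ball_lt_top.ne, ← ENNReal.ofReal_mul (by positivity)]
        exact ENNReal.ofReal_le_ofReal hJ)
  have hhalf : Metric.ball (0 : EuclideanSpace ℝ (Fin n)) (r / 2) ⊆ Ω :=
    Metric.ball_subset_ball (by linarith)
  have hfin : IsFiniteMeasure
      (volume.restrict (Metric.ball (0 : EuclideanSpace ℝ (Fin n)) (r / 2))) :=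
    isFiniteMeasure_restrict.2 measure_ball_lt_top.ne
  have hT : MemLp (fun x => max (u x - K) 0) 2
      (volume.restrict (Metric.ball (0 : EuclideanSpace ℝ (Fin n)) (r / 2))) :=
    ((hu.memLp.mono_measure (Measure.restrict_mono_set _ hhalf)).sub (memLp_const K)).pos_part
  have hTw : eLpNorm (fun x => max (u x - K) 0) 2
      (volume.restrict (Metric.ball (0 : EuclideanSpace ℝ (Fin n)) (r / 2))) ≤
      eLpNorm (fun x => max (η x * u x - K) 0) 2 volume := by
    refine le_trans (eLpNorm_congr_ae ?_).le (eLpNorm_mono_measure _ Measure.restrict_le_self)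
    filter_upwards [ae_restrict_mem Metric.isOpen_ball.measurableSet] with x hx
    rw [hηone x hx, one_mul]
  have hfinal : eLpNorm (fun x => max (u x - K) 0) 2
      (volume.restrict (Metric.ball (0 : EuclideanSpace ℝ (Fin n)) (r / 2))) ≤
      ENNReal.ofReal (δ * (C * M)) * eLpNorm u 2 (volume.restrict Ω) :=
    calc _ ≤ ENNReal.ofReal (δ * r) *
          (ENNReal.ofReal (C * (M / r)) * eLpNorm u 2 (volume.restrict Ω)) :=
          hTw.trans (htr.trans (by gcongr))
      _ = _ := by
        rw [← mul_assoc, ← ENNReal.ofReal_mul (by positivity)]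
        congr 2
        field_simp
  have hsq := pow_le_pow_left₀ zero_le hfinal 2
  rw [mul_pow, ← ofReal_integral_sq hT, ← ofReal_integral_sq hu.memLp,
    ← ENNReal.ofReal_pow (by positivity), ← ENNReal.ofReal_mul (by positivity)] at hsq
  exact (ENNReal.ofReal_le_ofReal_iff (by positivity)).1 hsq

end DeGiorgi

/-! ### Choice of constants. -/

theorem mainTheorem4 (n : ℕ) (hn : 1 ≤ n) (lam Lam : ℝ) (hlam : 0 < lam) (hLam : lam ≤ Lam) :
    ∃ A : ℝ, 1 < A ∧
      ∀ (r : ℝ), 0 < r →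
      ∀ (a : EuclideanSpace ℝ (Fin n) → Matrix (Fin n) (Fin n) ℝ),
        DeGiorgi.IsUniformlyElliptic lam Lam (Metric.ball 0 r) a →
      ∀ (u : EuclideanSpace ℝ (Fin n) → ℝ),
        DeGiorgi.IsSubsolution a (Metric.ball 0 r) u →
        (∀ᵐ x ∂(volume.restrict (Metric.ball (0 : EuclideanSpace ℝ (Fin n)) r)), 0 ≤ u x) →
        DeGiorgi.l2Average (Metric.ball 0 (r / 2))
            (fun x => max (u x - A * DeGiorgi.l2Average (Metric.ball 0 r) u) 0)
          ≤ 1 / 2 * DeGiorgi.l2Average (Metric.ball 0 r) u := by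
  obtain ⟨D, hD, htrunc⟩ := DeGiorgi.exists_integral_truncation_le hn hlam hLam
  -- The factor `2 ^ n` pays for the volume ratio of `B_r` to `B_{r/2}`, and `D + 1` avoids division
  -- by zero.
  set δ : ℝ := 1 / (2 * 2 ^ n * (D + 1)) with hδ
  have h2n : (1 : ℝ) ≤ 2 ^ n := one_le_pow₀ (by norm_num)
  have hδ0 : 0 < δ := by positivity
  have hδ1 : δ ≤ 1 := by
    rw [hδ, div_le_one (by positivity)]
    nlinarith
  have hδn : δ ^ n ≤ 1 := pow_le_one₀ hδ0.le hδ1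
  have hδn0 : 0 < δ ^ n := by positivity
  have hδD : δ * D ≤ 1 / (2 * 2 ^ n) := by
    rw [hδ, div_mul_eq_mul_div, one_mul, div_le_div_iff₀ (by positivity) (by positivity)]
    nlinarith
  have hδD2 : (δ * D) ^ 2 ≤ 1 / 4 * (1 / 2) ^ n :=
    calc (δ * D) ^ 2 ≤ (1 / (2 * 2 ^ n)) ^ 2 := by gcongr
      _ = 1 / 4 * (1 / 2) ^ n * (1 / 2 ^ n) := by rw [div_pow 1 2 n, one_pow]; field_simp; norm_num
      _ ≤ 1 / 4 * (1 / 2) ^ n * 1 := by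
        gcongr
        exact (div_le_one (by positivity)).2 h2n
      _ = _ := mul_one _
  -- With `A = 2 / δ ^ n` one has `A² δ ^ n = 4 / δ ^ n ≥ 1`, which is the level condition for `K =
  -- A m`.
  refine ⟨2 / δ ^ n, ?_, fun r hr a ha u hu hu0 => ?_⟩
  · rw [lt_div_iff₀ hδn0]
    linarith
  set J := ∫ x in Metric.ball (0 : EuclideanSpace ℝ (Fin n)) r, u x ^ 2 with hJ
  set V := volume.real (Metric.ball (0 : EuclideanSpace ℝ (Fin n)) r) with hV
  have hJ0 : 0 ≤ J := integral_nonneg fun x => sq_nonneg _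
  have hV0 : 0 < V := ENNReal.toReal_pos (Metric.measure_ball_pos volume _ hr).ne'
    measure_ball_lt_top.ne
  set m := DeGiorgi.l2Average (Metric.ball 0 r) u with hm
  have hm0 : 0 ≤ m := Real.sqrt_nonneg _
  have hm2 : m ^ 2 = V⁻¹ * J := by
    rw [hm, DeGiorgi.l2Average, setAverage_eq, smul_eq_mul, Real.sq_sqrt (by positivity)]
  have hlevel : J ≤ (2 / δ ^ n * m) ^ 2 *
      volume.real (Metric.ball (0 : EuclideanSpace ℝ (Fin n)) (δ * r)) := by
    rw [DeGiorgi.measureReal_ball_mul hδ0, mul_pow, hm2]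
    calc J ≤ 4 / δ ^ n * J := by
          refine le_mul_of_one_le_left hJ0 ?_
          rw [le_div_iff₀ hδn0]
          linarith
      _ = _ := by
        rw [← hV]
        field_simp
        ring
  have hmain := htrunc hr hδ0 (by positivity) ha hu hu0 hlevel
  rw [DeGiorgi.l2Average, setAverage_eq, smul_eq_mul]
  refine Real.sqrt_le_iff.2 ⟨by positivity, ?_⟩
  rw [show r / 2 = 1 / 2 * r by ring] at hmain ⊢
  rw [DeGiorgi.measureReal_ball_mul (by norm_num), ← hV, mul_pow, hm2]
  calc _ ≤ ((1 / 2) ^ n * V)⁻¹ * (1 / 4 * (1 / 2) ^ n * J) := by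
        refine mul_le_mul_of_nonneg_left (hmain.trans ?_) (by positivity)
        exact mul_le_mul_of_nonneg_right hδD2 hJ0
    _ = _ := by
        rw [mul_inv]
        have : ((1 / 2 : ℝ) ^ n)⁻¹ * (1 / 2) ^ n = 1 := inv_mul_cancel₀ (by positivity)
        linear_combination (V⁻¹ * J / 4) * this
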